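/- Let $0 < n_1 < \dots < n_d < n$ be integers and put $n_0 = 0$. Let $\operatorname{Flag}(n_1,\dots,n_d;n)$ be the flag manifold of all flags $V_1 \subsetneq \dots \subsetneq V_d$ of linear subspaces of $\mathbb{R}^n$ with $\dim V_i = n_i$, with its smooth structure as a homogeneous space of $\mathrm{O}(n)$ (equivalently, of $\mathrm{GL}(n,\mathbb{R})$), and put $V_0 = \{0\}$. Then the set $$ \mathcal{R} = \bigl\{ R = \operatorname{diag}(R_1,\dots,R_d) \in \mathbb{R}^{nd\times nd} : R_i \in \mathbb{R}^{n\times n},\; R_i^2 = R_i = R_i^{\mathsf T},\; \operatorname{tr}(R_i) = n_i - n_{i-1} \text{ for all } i,\; R_i R_j = 0 \text{ for } i<j \bigr\} $$ is an embedded smooth submanifold of $\mathbb{R}^{nd\times nd}$, and $\operatorname{Flag}(n_1,\dots,n_d;n)$ is diffeomorphic to it. More precisely, the map $$ \{V_i\}_{i=1}^d \mapsto \operatorname{diag}(R_1,\dots,R_d), $$ where $R_i$ is the matrix of the orthogonal projection of $\mathbb{R}^n$ onto the orthogonal complement of $V_{i-1}$ in $V_i$, is a diffeomorphism of $\operatorname{Flag}(n_1,\dots,n_d;n)$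 onto $\mathcal{R}$. -/

import Mathlib

open scoped Manifold ContDiff Matrix

/-- A type `0 < n₁ < ⋯ < n_d < n` of flags in `ℝⁿ`; `dim i` is `nᵢ`. -/
structure FlagType (n d : ℕ) where
  dim : Fin d → ℕ
  strictMono : StrictMono dim
  dim_pos : ∀ i, 0 < dim i
  dim_lt : ∀ i, dim i < n

/-- The set of flags `V₁ ⊊ ⋯ ⊊ V_d` of subspaces of `ℝⁿ` with `dim Vᵢ = nᵢ`. -/
@[ext]
structure FlagManifold {n d : ℕ} (τ : FlagType n d) where
  space : Fin d → Submodule ℝ (EuclideanSpace ℝ (Fin n))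
  strictMono : StrictMono space
  finrank_eq : ∀ i, Module.finrank ℝ (space i) = τ.dim i

namespace FlagType

variable {n d : ℕ} (τ : FlagType n d)

/-- `τ.prevDim i` is `nᵢ₋₁`, with `n₀ = 0`. -/
def prevDim (i : Fin d) : ℕ := (Fin.cons 0 τ.dim : Fin (d + 1) → ℕ) i.castSucc

/-- The positions `(a, b)` strictly below the diagonal blocks, for the block sizes
`n₁, n₂ - n₁, …, n - n_d`. -/
abbrev Index : Type :=
  {p : Fin n × Fin n // ∃ i : Fin d, (p.2 : ℕ) < τ.dim i ∧ τ.dim i ≤ (p.1 : ℕ)}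

/-- The model space of the flag manifold: one real coordinate for each position strictly below
the diagonal blocks, hence of dimension `∑_{i < j} (nᵢ - nᵢ₋₁)(nⱼ - nⱼ₋₁)`. -/
abbrev Model : Type := EuclideanSpace ℝ τ.Index

/-- The block lower unitriangular matrix with the entries `x` below the diagonal blocks. -/
def lowerMatrix (x : τ.Model) : Matrix (Fin n) (Fin n) ℝ :=
  fun a b => (if a = b then 1 else 0) +
    if h : ∃ i : Fin d, (b : ℕ) < τ.dim i ∧ τ.dim i ≤ (a : ℕ) then x ⟨(a, b), h⟩ else 0

variable {τ}

lemma lowerMatrix_index (x : τ.Model) (p : τ.Index) : τ.lowerMatrix x p.1.1 p.1.2 = x p := by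
  obtain ⟨⟨a, b⟩, h⟩ := p
  have hab : a ≠ b := by
    rintro rfl
    obtain ⟨i, h1, h2⟩ := h
    simp only at h1 h2
    omega
  have h' : ∃ i : Fin d, (b : ℕ) < τ.dim i ∧ τ.dim i ≤ (a : ℕ) := h
  simp only [lowerMatrix, if_neg hab, dif_pos h', zero_add]

lemma lowerMatrix_of_not (x : τ.Model) {a b : Fin n}
    (h : ¬ ∃ i : Fin d, (b : ℕ) < τ.dim i ∧ τ.dim i ≤ (a : ℕ)) :
    τ.lowerMatrix x a b = if a = b then 1 else 0 := by
  simp only [lowerMatrix, dif_neg h, add_zero]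

lemma lowerMatrix_zero : τ.lowerMatrix 0 = 1 := by
  ext a b
  simp [lowerMatrix, Matrix.one_apply]

lemma lowerMatrix_lt (x : τ.Model) {a b : Fin n} (h : a < b) : τ.lowerMatrix x a b = 0 := by
  rw [lowerMatrix_of_not, if_neg h.ne]
  rintro ⟨i, h1, h2⟩
  have : (a : ℕ) < b := h
  omega

lemma lowerMatrix_self (x : τ.Model) (a : Fin n) : τ.lowerMatrix x a a = 1 := by
  rw [lowerMatrix_of_not, if_pos rfl]
  rintro ⟨i, h1, h2⟩
  omega

/-- The first `m` columns of `A`. -/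
def cols (A : Matrix (Fin n) (Fin n) ℝ) (m : ℕ) : Matrix (Fin n) {c : Fin n // (c : ℕ) < m} ℝ :=
  fun a c => A a c

/-- The leading `m × m` block of `A`. -/
def lead (A : Matrix (Fin n) (Fin n) ℝ) (m : ℕ) :
    Matrix {c : Fin n // (c : ℕ) < m} {c : Fin n // (c : ℕ) < m} ℝ :=
  fun a c => A a c

lemma det_lead_lowerMatrix (x : τ.Model) (m : ℕ) : (lead (τ.lowerMatrix x) m).det = 1 := by
  rw [Matrix.det_of_isLowerTriangular]
  · simp [lead, lowerMatrix_self]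
  · intro i j hij
    exact lowerMatrix_lt x (by simpa using hij)

lemma isUnit_lowerMatrix (x : τ.Model) : IsUnit (τ.lowerMatrix x) := by
  rw [Matrix.isUnit_iff_isUnit_det, Matrix.det_of_isLowerTriangular]
  · simp [lowerMatrix_self]
  · intro i j hij
    exact lowerMatrix_lt x (by simpa using hij)

variable (τ) in
/-- The block lower unitriangular matrix as an element of `GL(n)`. -/
noncomputable def lower (x : τ.Model) : GL (Fin n) ℝ := (isUnit_lowerMatrix x).unit

lemma coe_lower (x : τ.Model) : (τ.lower x : Matrix (Fin n) (Fin n) ℝ) = τ.lowerMatrix x := rfl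

lemma lower_zero : τ.lower 0 = 1 := Units.ext (by rw [coe_lower, lowerMatrix_zero]; rfl)

/-- Each position lies below the last row of the diagonal block of its column. -/
lemma exists_least (p : τ.Index) : ∃ i : Fin d, (p.1.2 : ℕ) < τ.dim i ∧ τ.dim i ≤ (p.1.1 : ℕ) ∧
    ∀ j, (p.1.2 : ℕ) < τ.dim j → τ.dim i ≤ τ.dim j := by
  obtain ⟨i₀, h1, h2⟩ := p.2
  obtain ⟨i, hi, hmin⟩ := (Finset.univ.filter fun i : Fin d => (p.1.2 : ℕ) < τ.dim i).exists_min_image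
    τ.dim ⟨i₀, by simpa using h1⟩
  simp only [Finset.mem_filter, Finset.mem_univ, true_and] at hi hmin
  exact ⟨i, hi, (hmin i₀ h1).trans h2, hmin⟩

/-- The block lower unitriangular factor in a block `LU` decomposition of `A`. -/
noncomputable def lu (A : Matrix (Fin n) (Fin n) ℝ) : τ.Model := WithLp.toLp 2 fun p =>
  (cols A (τ.dim (exists_least p).choose) * (lead A (τ.dim (exists_least p).choose))⁻¹)
    p.1.1 ⟨p.1.2, (exists_least p).choose_spec.1⟩

end FlagType

namespace FlagManifold

open FlagType

variable {n d : ℕ} {τ : FlagType n d}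

/-- The `b`-th column of a matrix. -/
noncomputable def column (A : Matrix (Fin n) (Fin n) ℝ) (b : Fin n) : EuclideanSpace ℝ (Fin n) :=
  WithLp.toLp 2 fun a => A a b

lemma linearIndependent_column (g : GL (Fin n) ℝ) :
    LinearIndependent ℝ (column (g : Matrix (Fin n) (Fin n) ℝ)) := by
  have h := (Matrix.linearIndependent_cols_iff_isUnit (A := (g : Matrix (Fin n) (Fin n) ℝ))).2 g.isUnit
  exact h.map' (WithLp.linearEquiv 2 ℝ (Fin n → ℝ)).symm.toLinearMap (LinearEquiv.ker _)

/-- The span of the first `m` columns of `A`. -/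
noncomputable def columnSpan (A : Matrix (Fin n) (Fin n) ℝ) (m : ℕ) :
    Submodule ℝ (EuclideanSpace ℝ (Fin n)) :=
  Submodule.span ℝ (column A '' {b | (b : ℕ) < m})

lemma finrank_columnSpan (g : GL (Fin n) ℝ) {m : ℕ} (hm : m ≤ n) :
    Module.finrank ℝ (columnSpan (g : Matrix (Fin n) (Fin n) ℝ) m) = m := by
  have h := (linearIndependent_column g).comp (Fin.castLE hm) (Fin.castLE_injective hm)
  have e : column (g : Matrix (Fin n) (Fin n) ℝ) '' {b | (b : ℕ) < m} =
      Set.range (column (g : Matrix (Fin n) (Fin n) ℝ) ∘ Fin.castLE hm) := by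
    rw [Set.range_comp, Fin.range_castLE]
  rw [columnSpan, e, finrank_span_eq_card h, Fintype.card_fin]

lemma columnSpan_mono (A : Matrix (Fin n) (Fin n) ℝ) {m m' : ℕ} (h : m ≤ m') :
    columnSpan A m ≤ columnSpan A m' :=
  Submodule.span_mono (Set.image_mono fun _ hb => lt_of_lt_of_le hb h)

/-- The flag spanned by the first columns of an invertible matrix: the image under `g` of the
standard coordinate flag. -/
noncomputable def ofGL (τ : FlagType n d) (g : GL (Fin n) ℝ) : FlagManifold τ where
  space i := columnSpan (g : Matrix (Fin n) (Fin n) ℝ) (τ.dim i)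
  strictMono := by
    intro i j hij
    refine lt_of_le_of_ne (columnSpan_mono _ (τ.strictMono hij).le) fun h => ?_
    have h' := congrArg (fun W : Submodule ℝ _ => Module.finrank ℝ W) h
    simp only [finrank_columnSpan g (τ.dim_lt _).le] at h'
    exact (τ.strictMono hij).ne h'
  finrank_eq i := finrank_columnSpan g (τ.dim_lt i).le

lemma column_mem_columnSpan_iff (A : Matrix (Fin n) (Fin n) ℝ) (g : GL (Fin n) ℝ) (b : Fin n)
    (m : ℕ) : column A b ∈ columnSpan (g : Matrix (Fin n) (Fin n) ℝ) m ↔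
      ∀ a : Fin n, m ≤ (a : ℕ) → ((g⁻¹ : GL (Fin n) ℝ) * A : Matrix (Fin n) (Fin n) ℝ) a b = 0 := by
  constructor
  · intro h a ha
    let L : EuclideanSpace ℝ (Fin n) →ₗ[ℝ] ℝ :=
      { toFun := fun v => ∑ c, ((g⁻¹ : GL (Fin n) ℝ) : Matrix (Fin n) (Fin n) ℝ) a c * v c
        map_add' := fun v w => by simp [mul_add, Finset.sum_add_distrib]
        map_smul' := fun r v => by simp [Finset.mul_sum, mul_left_comm] }
    have hle : columnSpan (g : Matrix (Fin n) (Fin n) ℝ) m ≤ LinearMap.ker L := by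
      rw [columnSpan, Submodule.span_le]
      rintro _ ⟨c, hc, rfl⟩
      have h1 : ((g⁻¹ : GL (Fin n) ℝ) * (g : Matrix (Fin n) (Fin n) ℝ) :
          Matrix (Fin n) (Fin n) ℝ) a c = 0 := by
        rw [← Units.val_mul, inv_mul_cancel, Units.val_one, Matrix.one_apply_ne]
        rintro rfl
        exact absurd hc (not_lt.2 ha)
      exact h1
    exact hle h
  · intro h
    have h1 : column A b = ∑ c, ((g⁻¹ : GL (Fin n) ℝ) * A : Matrix (Fin n) (Fin n) ℝ) c b •
        column (g : Matrix (Fin n) (Fin n) ℝ) c := by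
      ext a
      have h2 : A = (g : Matrix (Fin n) (Fin n) ℝ) * ((g⁻¹ : GL (Fin n) ℝ) * A) := by
        rw [← Matrix.mul_assoc, ← Units.val_mul, mul_inv_cancel, Units.val_one, Matrix.one_mul]
      have h3 := congrFun (congrFun h2 a) b
      rw [Matrix.mul_apply] at h3
      simp only [column, WithLp.ofLp_sum, WithLp.ofLp_smul, Finset.sum_apply, Pi.smul_apply,
        smul_eq_mul]
      rw [h3]
      exact Finset.sum_congr rfl fun c _ => mul_comm _ _
    rw [h1]
    refine Submodule.sum_mem _ fun c _ => ?_
    by_cases hc : (c : ℕ) < m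
    · exact Submodule.smul_mem _ _ (Submodule.subset_span ⟨c, hc, rfl⟩)
    · rw [h c (not_lt.1 hc), zero_smul]
      exact Submodule.zero_mem _

lemma ofGL_eq_iff (g h : GL (Fin n) ℝ) : ofGL τ g = ofGL τ h ↔
    ∀ (i : Fin d) (a b : Fin n), (b : ℕ) < τ.dim i → τ.dim i ≤ (a : ℕ) →
      ((h⁻¹ : GL (Fin n) ℝ) * (g : Matrix (Fin n) (Fin n) ℝ) : Matrix (Fin n) (Fin n) ℝ) a b = 0 := by
  constructor
  · intro e i a b hb ha
    refine (column_mem_columnSpan_iff _ h b (τ.dim i)).1 ?_ a ha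
    have e' : columnSpan (g : Matrix (Fin n) (Fin n) ℝ) (τ.dim i) = columnSpan h (τ.dim i) :=
      congrArg (fun V : FlagManifold τ => V.space i) e
    rw [← e']
    exact Submodule.subset_span ⟨b, hb, rfl⟩
  · intro H
    ext1
    funext i
    refine Submodule.eq_of_le_of_finrank_eq ?_ ?_
    · refine Submodule.span_le.2 ?_
      rintro _ ⟨b, hb, rfl⟩
      exact (column_mem_columnSpan_iff _ h b (τ.dim i)).2 fun a ha => H i a b hb ha
    · rw [(ofGL τ g).finrank_eq, (ofGL τ h).finrank_eq]

lemma ofGL_mul_eq_iff (k g h : GL (Fin n) ℝ) :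
    ofGL τ (k * g) = ofGL τ (k * h) ↔ ofGL τ g = ofGL τ h := by
  rw [ofGL_eq_iff, ofGL_eq_iff, ← Units.val_mul, ← Units.val_mul]
  simp only [mul_inv_rev, mul_assoc, inv_mul_cancel_left]

lemma cols_mul {B P : Matrix (Fin n) (Fin n) ℝ} {m : ℕ}
    (h : ∀ a b : Fin n, (b : ℕ) < m → m ≤ (a : ℕ) → P a b = 0) :
    cols (B * P) m = cols B m * lead P m := by
  ext a b
  simp only [cols, lead, Matrix.mul_apply]
  rw [← Fintype.sum_subtype_add_sum_subtype (fun c : Fin n => (c : ℕ) < m), add_eq_left]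
  refine Finset.sum_eq_zero fun c _ => ?_
  rw [h c b b.2 (not_lt.1 c.2), mul_zero]

lemma lead_mul {B P : Matrix (Fin n) (Fin n) ℝ} {m : ℕ}
    (h : ∀ a b : Fin n, (b : ℕ) < m → m ≤ (a : ℕ) → P a b = 0) :
    lead (B * P) m = lead B m * lead P m := by
  ext a b
  exact congrFun (congrFun (cols_mul (B := B) h) a) b

/-- A matrix has a block `LU` decomposition iff its leading block minors do not vanish, and then
the lower factor is unique. -/
lemma ofGL_eq_lower_iff (g : GL (Fin n) ℝ) (y : τ.Model) : ofGL τ g = ofGL τ (τ.lower y) ↔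
    (∀ i, (lead (g : Matrix (Fin n) (Fin n) ℝ) (τ.dim i)).det ≠ 0) ∧
    y = lu (g : Matrix (Fin n) (Fin n) ℝ) := by
  constructor
  · intro e
    rw [ofGL_eq_iff] at e
    set P : GL (Fin n) ℝ := (τ.lower y)⁻¹ * g with hP
    have hg : (g : Matrix (Fin n) (Fin n) ℝ) = τ.lowerMatrix y * (P : Matrix (Fin n) (Fin n) ℝ) := by
      rw [hP, ← coe_lower, ← Units.val_mul, mul_inv_cancel_left]
    rw [← Units.val_mul, ← hP] at e
    have hcols := fun i => cols_mul (B := τ.lowerMatrix y) (e i)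
    have hlead := fun i => lead_mul (B := τ.lowerMatrix y) (e i)
    rw [← hg] at hcols hlead
    have hPdet : ∀ i, (lead (P : Matrix (Fin n) (Fin n) ℝ) (τ.dim i)).det ≠ 0 := by
      intro i h0
      have h1 := Matrix.twoBlockTriangular_det (P : Matrix (Fin n) (Fin n) ℝ)
        (fun c => (c : ℕ) < τ.dim i) (fun a ha b hb => e i a b hb (not_lt.1 ha))
      have h2 : (Matrix.toSquareBlockProp (P : Matrix (Fin n) (Fin n) ℝ)
        (fun c => (c : ℕ) < τ.dim i)).det = 0 := h0
      rw [h2, zero_mul] at h1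
      have h3 := (Matrix.isUnit_iff_isUnit_det _).1 P.isUnit
      rw [h1] at h3
      exact not_isUnit_zero h3
    refine ⟨fun i => ?_, ?_⟩
    · rw [hlead i, Matrix.det_mul, det_lead_lowerMatrix, one_mul]
      exact hPdet i
    · ext p
      obtain ⟨h1, h2, h3⟩ := (exists_least p).choose_spec
      have h7 : lu (g : Matrix (Fin n) (Fin n) ℝ) p =
        (cols (g : Matrix (Fin n) (Fin n) ℝ) (τ.dim (exists_least p).choose) *
          (lead (g : Matrix (Fin n) (Fin n) ℝ) (τ.dim (exists_least p).choose))⁻¹)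
          p.1.1 ⟨p.1.2, h1⟩ := rfl
      rw [h7]
      set i := (exists_least p).choose with hi
      set U := lead (τ.lowerMatrix y) (τ.dim i) with hU
      set Q := lead (P : Matrix (Fin n) (Fin n) ℝ) (τ.dim i) with hQ
      have hUu : IsUnit U.det := by rw [hU, det_lead_lowerMatrix]; exact isUnit_one
      have hQu : IsUnit Q.det := (hPdet i).isUnit
      have hcol : ∀ c, U c ⟨p.1.2, h1⟩ =
          (1 : Matrix {c : Fin n // (c : ℕ) < τ.dim i} {c : Fin n // (c : ℕ) < τ.dim i} ℝ) c ⟨p.1.2, h1⟩ := by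
        intro c
        rw [hU, lead, lowerMatrix_of_not]
        · simp [Matrix.one_apply, Subtype.ext_iff]
        · rintro ⟨j, hj1, hj2⟩
          have := h3 j hj1
          have := c.2
          omega
      have hinv : ∀ c, U⁻¹ c ⟨p.1.2, h1⟩ =
          (1 : Matrix {c : Fin n // (c : ℕ) < τ.dim i} {c : Fin n // (c : ℕ) < τ.dim i} ℝ) c ⟨p.1.2, h1⟩ := by
        intro c
        have h4 : (U⁻¹ * U) c ⟨p.1.2, h1⟩ = U⁻¹ c ⟨p.1.2, h1⟩ := by
          rw [Matrix.mul_apply]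
          simp only [hcol]
          rw [← Matrix.mul_apply, Matrix.mul_one]
        rw [← h4, Matrix.nonsing_inv_mul _ hUu]
      rw [hcols i, hlead i, ← hU, ← hQ, Matrix.mul_inv_rev, Matrix.mul_assoc,
          ← Matrix.mul_assoc Q, Matrix.mul_nonsing_inv _ hQu, Matrix.one_mul, Matrix.mul_apply]
      simp only [hinv]
      rw [← Matrix.mul_apply, Matrix.mul_one, cols]
      exact (lowerMatrix_index y p).symm
  · rintro ⟨hdet, rfl⟩
    rw [eq_comm, ofGL_eq_iff]
    intro j a b hb ha
    have hp : ∃ i : Fin d, (b : ℕ) < τ.dim i ∧ τ.dim i ≤ (a : ℕ) := ⟨j, hb, ha⟩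
    obtain ⟨h1, h2, h3⟩ := (exists_least (⟨(a, b), hp⟩ : τ.Index)).choose_spec
    simp only at h1 h2 h3
    set i := (exists_least (⟨(a, b), hp⟩ : τ.Index)).choose with hi
    set A := (g : Matrix (Fin n) (Fin n) ℝ) with hA
    have key : ∀ a', τ.lowerMatrix (lu A) a' b =
        (cols A (τ.dim i) * (lead A (τ.dim i))⁻¹) a' ⟨b, h1⟩ := by
      intro a'
      by_cases ha' : (a' : ℕ) < τ.dim i
      · have h4 : (lead A (τ.dim i) * (lead A (τ.dim i))⁻¹) ⟨a', ha'⟩ ⟨b, h1⟩ =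
            (1 : Matrix {c : Fin n // (c : ℕ) < τ.dim i} {c : Fin n // (c : ℕ) < τ.dim i} ℝ) ⟨a', ha'⟩ ⟨b, h1⟩ := by
          rw [Matrix.mul_nonsing_inv _ (hdet i).isUnit]
        have h5 : (cols A (τ.dim i) * (lead A (τ.dim i))⁻¹) a' ⟨b, h1⟩ =
            (lead A (τ.dim i) * (lead A (τ.dim i))⁻¹) ⟨a', ha'⟩ ⟨b, h1⟩ := rfl
        rw [h5, h4, lowerMatrix_of_not]
        · simp [Matrix.one_apply]
        · rintro ⟨k, hk1, hk2⟩
          have := h3 k hk1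
          omega
      · have hq : ∃ i : Fin d, (b : ℕ) < τ.dim i ∧ τ.dim i ≤ (a' : ℕ) := ⟨i, h1, not_lt.1 ha'⟩
        have h6 := lowerMatrix_index (lu A) (⟨(a', b), hq⟩ : τ.Index)
        simp only at h6
        rw [h6]
        obtain ⟨q1, q2, q3⟩ := (exists_least (⟨(a', b), hq⟩ : τ.Index)).choose_spec
        simp only at q1 q2 q3
        have hii : (exists_least (⟨(a', b), hq⟩ : τ.Index)).choose = i :=
          τ.strictMono.injective (le_antisymm (q3 i h1) (h3 _ q1))
        have h7 : ∀ (k : Fin d) (hk : (b : ℕ) < τ.dim k), k = i →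
            (cols A (τ.dim k) * (lead A (τ.dim k))⁻¹) a' ⟨b, hk⟩ =
            (cols A (τ.dim i) * (lead A (τ.dim i))⁻¹) a' ⟨b, h1⟩ := by
          rintro k hk rfl
          rfl
        exact h7 _ q1 hii
    have hia : τ.dim i ≤ (a : ℕ) := h2
    rw [Matrix.mul_apply]
    simp only [coe_lower, key]
    rw [← Matrix.mul_apply, ← Matrix.mul_assoc]
    have h8 : ((g⁻¹ : GL (Fin n) ℝ) : Matrix (Fin n) (Fin n) ℝ) * cols A (τ.dim i) =
        cols (1 : Matrix (Fin n) (Fin n) ℝ) (τ.dim i) := by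
      have h9 : ((g⁻¹ : GL (Fin n) ℝ) : Matrix (Fin n) (Fin n) ℝ) * A = 1 := by
        rw [hA, ← Units.val_mul, inv_mul_cancel, Units.val_one]
      rw [← h9]
      rfl
    rw [h8, Matrix.mul_apply]
    refine Finset.sum_eq_zero fun c _ => ?_
    rw [cols, Matrix.one_apply_ne, zero_mul]
    intro hac
    have := c.2
    rw [← hac] at this
    exact absurd this (not_lt.2 hia)

/-- The affine chart of the big cell moved by `g`, as a parametrisation: `x` is sent to the flag
spanned by the first columns of `g L(x)`, where `L(x)` is block lower unitriangular. -/
noncomputable def param (τ : FlagType n d) (g : GL (Fin n) ℝ) (x : τ.Model) : FlagManifold τ :=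
  ofGL τ (g * τ.lower x)

lemma param_eq_param_iff (g h : GL (Fin n) ℝ) (x y : τ.Model) :
    param τ g x = param τ h y ↔
    (∀ i, (lead (((h⁻¹ * g : GL (Fin n) ℝ) : Matrix (Fin n) (Fin n) ℝ) * τ.lowerMatrix x)
      (τ.dim i)).det ≠ 0) ∧
    y = lu (((h⁻¹ * g : GL (Fin n) ℝ) : Matrix (Fin n) (Fin n) ℝ) * τ.lowerMatrix x) := by
  have h1 : g * τ.lower x = h * (h⁻¹ * g * τ.lower x) := by group
  rw [param, param, h1, ofGL_mul_eq_iff, ofGL_eq_lower_iff]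
  rfl

lemma param_injective (g : GL (Fin n) ℝ) : Function.Injective (param τ g) := by
  intro x y h
  rw [((param_eq_param_iff g g x y).1 h).2, ← ((param_eq_param_iff g g x x).1 rfl).2]

/-- The chart inverse to `param τ g`. -/
noncomputable def chart (τ : FlagType n d) (g : GL (Fin n) ℝ) :
    PartialEquiv (FlagManifold τ) τ.Model :=
  ((param_injective (τ := τ) g).injOn.toPartialEquiv (param τ g) Set.univ).symm

lemma mem_chart_source (g : GL (Fin n) ℝ) (V : FlagManifold τ) :
    V ∈ (chart τ g).source ↔ ∃ x, param τ g x = V := by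
  change V ∈ param τ g '' Set.univ ↔ _
  simp

lemma chart_param (g : GL (Fin n) ℝ) (x : τ.Model) : chart τ g (param τ g x) = x :=
  ((param_injective (τ := τ) g).injOn.toPartialEquiv (param τ g) Set.univ).left_inv
    (Set.mem_univ x)

lemma exists_adapted (V : FlagManifold τ) (m : ℕ) (hm : m ≤ n) :
    ∃ v : Fin m → EuclideanSpace ℝ (Fin n), LinearIndependent ℝ v ∧
      ∀ (b : Fin m) (i : Fin d), (b : ℕ) < τ.dim i → v b ∈ V.space i := by
  induction m with
  | zero => exact ⟨Fin.elim0, linearIndependent_empty_type, fun b => b.elim0⟩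
  | succ m ih =>
    obtain ⟨v, hv, hmem⟩ := ih (by omega)
    obtain ⟨W, hW, hWV⟩ : ∃ W : Submodule ℝ (EuclideanSpace ℝ (Fin n)),
        m < Module.finrank ℝ W ∧ ∀ i, m < τ.dim i → W ≤ V.space i := by
      by_cases h : ∃ i, m < τ.dim i
      · obtain ⟨i₀, hi₀⟩ := h
        obtain ⟨i, hi, hmin⟩ := (Finset.univ.filter fun i : Fin d =>
          m < τ.dim i).exists_min_image id ⟨i₀, by simpa using hi₀⟩
        simp only [Finset.mem_filter, Finset.mem_univ, true_and, id] at hi hmin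
        exact ⟨V.space i, by rwa [V.finrank_eq], fun j hj => V.strictMono.monotone (hmin j hj)⟩
      · refine ⟨⊤, ?_, fun i hi => absurd ⟨i, hi⟩ h⟩
        rw [finrank_top, finrank_euclideanSpace_fin]
        omega
    obtain ⟨w, hw, hwv⟩ : ∃ w ∈ W, w ∉ Submodule.span ℝ (Set.range v) := by
      by_contra! hcon
      have h1 := Submodule.finrank_mono (show W ≤ Submodule.span ℝ (Set.range v) from hcon)
      rw [finrank_span_eq_card hv, Fintype.card_fin] at h1
      omega
    refine ⟨Fin.snoc v w, linearIndependent_finSnoc.2 ⟨hv, hwv⟩, fun b i => ?_⟩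
    refine Fin.lastCases ?_ (fun b => ?_) b
    · intro hi
      rw [Fin.snoc_last]
      exact hWV i (by simpa using hi) hw
    · intro hi
      rw [Fin.snoc_castSucc]
      exact hmem b i (by simpa using hi)

/-- Every flag is spanned by the first columns of some invertible matrix. -/
lemma exists_ofGL_eq (V : FlagManifold τ) : ∃ g : GL (Fin n) ℝ, ofGL τ g = V := by
  obtain ⟨v, hv, hmem⟩ := exists_adapted V n le_rfl
  have hu : IsUnit (Matrix.of fun a b => v b a : Matrix (Fin n) (Fin n) ℝ) := by
    rw [← Matrix.linearIndependent_cols_iff_isUnit]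
    exact hv.map' (WithLp.linearEquiv 2 ℝ (Fin n → ℝ)).toLinearMap (LinearEquiv.ker _)
  refine ⟨hu.unit, ?_⟩
  ext1
  funext i
  refine Submodule.eq_of_le_of_finrank_eq ?_ ?_
  · refine Submodule.span_le.2 ?_
    rintro _ ⟨b, hb, rfl⟩
    exact hmem b i hb
  · rw [(ofGL τ hu.unit).finrank_eq, V.finrank_eq]

lemma exists_mem_chart_source (V : FlagManifold τ) : ∃ g, V ∈ (chart τ g).source := by
  obtain ⟨g, rfl⟩ := exists_ofGL_eq V
  refine ⟨g, (mem_chart_source g _).2 ⟨0, ?_⟩⟩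
  rw [param, lower_zero, mul_one]

lemma trans_source (g h : GL (Fin n) ℝ) : ((chart τ g).symm.trans (chart τ h)).source =
    {x | ∀ i, (lead (((h⁻¹ * g : GL (Fin n) ℝ) : Matrix (Fin n) (Fin n) ℝ) * τ.lowerMatrix x)
      (τ.dim i)).det ≠ 0} := by
  ext x
  have h1 : x ∈ ((chart τ g).symm.trans (chart τ h)).source ↔
      x ∈ (Set.univ : Set τ.Model) ∧ param τ g x ∈ (chart τ h).source := by
    rw [PartialEquiv.trans_source]
    rfl
  rw [h1, mem_chart_source]
  constructor
  · rintro ⟨-, y, hy⟩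
    exact ((param_eq_param_iff g h x y).1 hy.symm).1
  · intro hx
    exact ⟨Set.mem_univ _, _, ((param_eq_param_iff g h x _).2 ⟨hx, rfl⟩).symm⟩

lemma trans_eqOn (g h : GL (Fin n) ℝ) : Set.EqOn ((chart τ g).symm.trans (chart τ h))
    (fun x => lu (((h⁻¹ * g : GL (Fin n) ℝ) : Matrix (Fin n) (Fin n) ℝ) * τ.lowerMatrix x))
    ((chart τ g).symm.trans (chart τ h)).source := by
  intro x hx
  rw [trans_source] at hx
  have h1 := (param_eq_param_iff g h x _).2 ⟨hx, rfl⟩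
  change chart τ h (param τ g x) = _
  rw [h1, chart_param]

lemma contDiff_entry (M : Matrix (Fin n) (Fin n) ℝ) (a b : Fin n) :
    ContDiff ℝ ∞ fun x : τ.Model => (M * τ.lowerMatrix x) a b := by
  simp only [Matrix.mul_apply]
  refine ContDiff.sum fun c _ => contDiff_const.mul ?_
  by_cases h : ∃ i : Fin d, (b : ℕ) < τ.dim i ∧ τ.dim i ≤ (c : ℕ)
  · simp only [lowerMatrix, dif_pos h]
    exact contDiff_const.add (contDiff_euclidean.1 contDiff_id _)
  · simp only [lowerMatrix, dif_neg h]
    exact contDiff_const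

lemma contDiff_det {E ι : Type} [NormedAddCommGroup E] [NormedSpace ℝ E] [Fintype ι]
    [DecidableEq ι] {f : E → Matrix ι ι ℝ} (hf : ∀ a b, ContDiff ℝ ∞ fun x => f x a b) :
    ContDiff ℝ ∞ fun x => (f x).det := by
  simp only [Matrix.det_apply']
  exact ContDiff.sum fun σ _ => contDiff_const.mul (contDiff_prod fun c _ => hf _ _)

lemma contDiffOn_trans (g h : GL (Fin n) ℝ) :
    ContDiffOn ℝ ∞ ((chart τ g).symm.trans (chart τ h))
      ((chart τ g).symm.trans (chart τ h)).source := by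
  refine ContDiffOn.congr ?_ (trans_eqOn g h)
  rw [trans_source, contDiffOn_euclidean]
  set M : Matrix (Fin n) (Fin n) ℝ := ((h⁻¹ * g : GL (Fin n) ℝ) : Matrix (Fin n) (Fin n) ℝ)
  intro p
  simp only [lu, Matrix.mul_apply, Matrix.inv_def, Ring.inverse_eq_inv', Matrix.smul_apply,
    smul_eq_mul]
  refine ContDiffOn.sum fun c _ => ?_
  refine ContDiffOn.mul (contDiff_entry M _ _).contDiffOn (ContDiffOn.mul ?_ ?_)
  · refine ContDiffOn.inv (ContDiff.contDiffOn (contDiff_det fun a b => contDiff_entry M _ _)) ?_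
    intro x hx
    exact hx _
  · refine ContDiff.contDiffOn ?_
    simp only [Matrix.adjugate_apply]
    refine contDiff_det fun a b => ?_
    simp only [Matrix.updateRow_apply]
    split_ifs
    · exact contDiff_const
    · exact contDiff_entry M _ _

lemma isOpen_trans_source (g h : GL (Fin n) ℝ) :
    IsOpen ((chart τ g).symm.trans (chart τ h)).source := by
  rw [trans_source, Set.ofPred_forall]
  refine isOpen_iInter_of_finite fun i => ?_
  exact isOpen_ne.preimage (contDiff_det fun a b => contDiff_entry _ _ _).continuous

/-- The smooth atlas of the flag manifold: all translates under `GL(n)` of the big cell. The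
topology and the smooth structure it defines are those of the homogeneous space of the transitive
action of `GL(n)` (equivalently, of `O(n)`) on flags. -/
noncomputable def core (τ : FlagType n d) : ChartedSpaceCore τ.Model (FlagManifold τ) where
  atlas := Set.range (chart τ)
  chartAt V := chart τ (exists_mem_chart_source V).choose
  mem_chart_source V := (exists_mem_chart_source V).choose_spec
  chart_mem_atlas V := Set.mem_range_self _
  open_source := by
    rintro _ _ ⟨g, rfl⟩ ⟨h, rfl⟩
    exact isOpen_trans_source g h
  continuousOn_toFun := by
    rintro _ _ ⟨g, rfl⟩ ⟨h, rfl⟩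
    exact (contDiffOn_trans g h).continuousOn

noncomputable instance : TopologicalSpace (FlagManifold τ) := (core τ).toTopologicalSpace

noncomputable instance : ChartedSpace τ.Model (FlagManifold τ) := (core τ).toChartedSpace

instance : IsManifold 𝓘(ℝ, τ.Model) ∞ (FlagManifold τ) := by
  refine isManifold_of_contDiffOn _ _ _ ?_
  intro e e' he he'
  have key : ∀ e ∈ atlas τ.Model (FlagManifold τ), ∃ g, e.toPartialEquiv = chart τ g := by
    intro e he
    obtain ⟨f, hf⟩ := Set.mem_iUnion.1 he
    obtain ⟨⟨g, rfl⟩, hf⟩ := Set.mem_iUnion.1 hf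
    rw [Set.mem_singleton_iff] at hf
    exact ⟨g, by rw [hf]; rfl⟩
  obtain ⟨g, hg⟩ := key e he
  obtain ⟨h, hh⟩ := key e' he'
  have h1 : (e.symm.trans e').toPartialEquiv = (chart τ g).symm.trans (chart τ h) := by
    rw [← hg, ← hh]
    rfl
  have h2 := contDiffOn_trans (τ := τ) g h
  rw [← h1] at h2
  simpa using h2

/-- `V.prevSpace i` is `Vᵢ₋₁`, with `V₀ = 0`. -/
def prevSpace (V : FlagManifold τ) (i : Fin d) : Submodule ℝ (EuclideanSpace ℝ (Fin n)) :=
  (Fin.cons ⊥ V.space : Fin (d + 1) → Submodule ℝ (EuclideanSpace ℝ (Fin n))) i.castSucc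

/-- `V.projector i` is the matrix, in the standard basis, of the orthogonal projection of `ℝⁿ`
onto the orthogonal complement of `Vᵢ₋₁` in `Vᵢ`. -/
noncomputable def projector (V : FlagManifold τ) (i : Fin d) : Matrix (Fin n) (Fin n) ℝ :=
  Matrix.toEuclideanLin.symm
    ((V.space i ⊓ (V.prevSpace i)ᗮ).starProjection : EuclideanSpace ℝ (Fin n) →ₗ[ℝ] _)

/-- The reduced projection coordinates `diag(R₁, …, R_d)` of a flag. -/
noncomputable def reducedCoord (V : FlagManifold τ) : Matrix (Fin n × Fin d) (Fin n × Fin d) ℝ :=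
  Matrix.blockDiagonal V.projector

end FlagManifold

/-- The block diagonal matrices `diag(R₁, …, R_d)` with `Rᵢ² = Rᵢ = Rᵢᵀ`, `tr Rᵢ = nᵢ - nᵢ₋₁` and
`Rᵢ Rⱼ = 0` for `i < j`. -/
def reducedMatrices {n d : ℕ} (τ : FlagType n d) :
    Set (Matrix (Fin n × Fin d) (Fin n × Fin d) ℝ) :=
  {M | ∃ R : Fin d → Matrix (Fin n) (Fin n) ℝ, M = Matrix.blockDiagonal R ∧
    (∀ i, R i * R i = R i) ∧ (∀ i, (R i)ᵀ = R i) ∧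
    (∀ i, (R i).trace = (τ.dim i : ℝ) - (τ.prevDim i : ℝ)) ∧
    ∀ i j, i < j → R i * R j = 0}

/-! Let `P_k` be the orthogonal projection onto `V_k`. Since `R_i = P_i - P_{i-1}`, the partial sum
`R_1 + ⋯ + R_k` is `P_k`, so the coordinates determine the flag. Conversely, if the `R_i` satisfy
the defining equations, then transposing `R_i R_j = 0` gives `R_j R_i = 0`. The partial sums are
therefore symmetric idempotents of trace `n_k` with increasing ranges, and these ranges form a flag
(`exists_projector_eq`).

In a chart the flag is spanned by the first columns of `g L(x)`. If `C` denotes the first `n_i` of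
them, then `P_i = C (CᵀC)⁻¹ Cᵀ` (`orthProj_columnSpan`), which is smooth in `x`.

For the inverse, fix a base flag and a matrix adapted to it. Given an ambient matrix `M`, apply to
each column the partial sum of blocks of `M` that stands for the smallest `V_i` containing that
column. The result `H(M)` is smooth in `M`, is the given matrix at the base point, hence invertible
nearby, and is adapted to `V` when `M` comes from `V`. A block `LU` decomposition of `g⁻¹ H(M)` then
yields a smooth map `ρ` on an ambient neighbourhood that recovers the chart coordinate
(`exists_local_inverse`).

This `ρ` makes the bijection a homeomorphism and the derivative of each parametrisation injective,
so the inverse function theorem gives the normal form of an immersion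
(`exists_chart_of_leftInverse`). With the smooth structure transported from the flag manifold, the
bijection is a diffeomorphism and the inclusion an embedding. -/

namespace FlagManifold

open FlagType

variable {n d : ℕ} {τ : FlagType n d}

/-! ### Matrices of orthogonal projections -/

/-- The matrix of the orthogonal projection onto a subspace of `ℝⁿ`. -/
noncomputable def orthProj (U : Submodule ℝ (EuclideanSpace ℝ (Fin n))) : Matrix (Fin n) (Fin n) ℝ :=
  (Matrix.toEuclideanCLM (n := Fin n) (𝕜 := ℝ)).symm U.starProjection

lemma toEuclideanCLM_orthProj (U : Submodule ℝ (EuclideanSpace ℝ (Fin n))) :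
    Matrix.toEuclideanCLM (n := Fin n) (𝕜 := ℝ) (orthProj U) = U.starProjection :=
  (Matrix.toEuclideanCLM (n := Fin n) (𝕜 := ℝ)).apply_symm_apply _

lemma isStarProjection_matrix_iff {S : Matrix (Fin n) (Fin n) ℝ} :
    IsStarProjection (Matrix.toEuclideanCLM (n := Fin n) (𝕜 := ℝ) S) ↔ S * S = S ∧ Sᵀ = S := by
  rw [isStarProjection_iff, IsIdempotentElem, IsSelfAdjoint, ← map_mul, ← map_star,
    EmbeddingLike.apply_eq_iff_eq, EmbeddingLike.apply_eq_iff_eq, Matrix.star_eq_conjTranspose,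
    Matrix.conjTranspose_eq_transpose_of_trivial]

lemma orthProj_mul_self (U : Submodule ℝ (EuclideanSpace ℝ (Fin n))) :
    orthProj U * orthProj U = orthProj U :=
  (isStarProjection_matrix_iff.1
    ((toEuclideanCLM_orthProj U).symm ▸ isStarProjection_starProjection)).1

lemma transpose_orthProj (U : Submodule ℝ (EuclideanSpace ℝ (Fin n))) :
    (orthProj U)ᵀ = orthProj U :=
  (isStarProjection_matrix_iff.1
    ((toEuclideanCLM_orthProj U).symm ▸ isStarProjection_starProjection)).2

lemma orthProj_injective : Function.Injective (orthProj (n := n)) := by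
  intro U W h
  have h1 := congrArg (Matrix.toEuclideanCLM (n := Fin n) (𝕜 := ℝ)) h
  rw [toEuclideanCLM_orthProj, toEuclideanCLM_orthProj] at h1
  exact Submodule.starProjection_inj.1 h1

/-- The column space of a square matrix. -/
noncomputable def matrixRange (S : Matrix (Fin n) (Fin n) ℝ) :
    Submodule ℝ (EuclideanSpace ℝ (Fin n)) :=
  LinearMap.range (Matrix.toEuclideanLin S)

lemma orthProj_matrixRange {S : Matrix (Fin n) (Fin n) ℝ} (h1 : S * S = S) (h2 : Sᵀ = S) :
    orthProj (matrixRange S) = S := by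
  have h := isStarProjection_iff_eq_starProjection_range.1 (isStarProjection_matrix_iff.2 ⟨h1, h2⟩)
  apply EquivLike.injective (Matrix.toEuclideanCLM (n := Fin n) (𝕜 := ℝ))
  rw [toEuclideanCLM_orthProj]
  obtain ⟨_, h⟩ := h
  exact h.symm

lemma matrixRange_orthProj (U : Submodule ℝ (EuclideanSpace ℝ (Fin n))) :
    matrixRange (orthProj U) = U :=
  orthProj_injective (orthProj_matrixRange (orthProj_mul_self U) (transpose_orthProj U))

/-- The trace of an idempotent is its rank; this turns trace conditions into dimensions. -/
lemma finrank_matrixRange {S : Matrix (Fin n) (Fin n) ℝ} (h : S * S = S) :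
    (Module.finrank ℝ (matrixRange S) : ℝ) = S.trace := by
  have h1 : IsIdempotentElem (Matrix.toEuclideanLin S) := by
    rw [← Matrix.coe_toEuclideanCLM_eq_toEuclideanLin]
    ext1 x
    have := congrArg (Matrix.toEuclideanCLM (n := Fin n) (𝕜 := ℝ)) h
    rw [map_mul] at this
    exact DFunLike.congr_fun this x
  rw [matrixRange, ← (LinearMap.IsIdempotentElem.isProj_range _ h1).trace,
    Matrix.toEuclideanLin_eq_toLin_orthonormal, Matrix.trace_toLin_eq]

lemma trace_orthProj (U : Submodule ℝ (EuclideanSpace ℝ (Fin n))) :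
    (orthProj U).trace = Module.finrank ℝ U := by
  rw [← finrank_matrixRange (orthProj_mul_self U), matrixRange_orthProj]

lemma orthProj_mul_eq_zero {U W : Submodule ℝ (EuclideanSpace ℝ (Fin n))} (h : W ≤ Uᗮ) :
    orthProj U * orthProj W = 0 := by
  apply EquivLike.injective (Matrix.toEuclideanCLM (n := Fin n) (𝕜 := ℝ))
  rw [map_mul, toEuclideanCLM_orthProj, toEuclideanCLM_orthProj, map_zero]
  ext1 x
  exact (Submodule.starProjection_apply_eq_zero_iff _).2 (h (W.starProjection_apply_mem x))

/-- The vector `P_U u - P_W u` lies in `U ⊓ Wᗮ`, and the remainder `(u - P_U u) + P_W u` is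
orthogonal to that space because each summand is. -/
lemma orthProj_inf_orthogonal {U W : Submodule ℝ (EuclideanSpace ℝ (Fin n))} (h : W ≤ U) :
    orthProj (U ⊓ Wᗮ) = orthProj U - orthProj W := by
  apply EquivLike.injective (Matrix.toEuclideanCLM (n := Fin n) (𝕜 := ℝ))
  rw [map_sub, toEuclideanCLM_orthProj, toEuclideanCLM_orthProj, toEuclideanCLM_orthProj]
  ext1 u
  have hU := U.sub_starProjection_mem_orthogonal u
  have hW := W.sub_starProjection_mem_orthogonal u
  refine Submodule.eq_starProjection_of_mem_orthogonal ⟨?_, ?_⟩ ?_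
  · exact U.sub_mem (U.starProjection_apply_mem u) (h (W.starProjection_apply_mem u))
  · have := Wᗮ.sub_mem hW (Submodule.orthogonal_le h hU)
    simpa using this
  · have h1 : u - (U.starProjection - W.starProjection) u =
        (u - U.starProjection u) + W.starProjection u := by
      simp only [sub_apply]
      abel
    rw [h1]
    refine Submodule.add_mem _ (Submodule.orthogonal_le inf_le_left hU) ?_
    exact Submodule.orthogonal_le inf_le_right
      (W.le_orthogonal_orthogonal (W.starProjection_apply_mem u))

/-! ### From a flag to its reduced coordinates -/

/-- The spaces `0 = V₀, V₁, …, V_d` of a flag. -/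
def fullSpace (V : FlagManifold τ) (k : Fin (d + 1)) : Submodule ℝ (EuclideanSpace ℝ (Fin n)) :=
  (Fin.cons ⊥ V.space : Fin (d + 1) → Submodule ℝ (EuclideanSpace ℝ (Fin n))) k

lemma fullSpace_zero (V : FlagManifold τ) : V.fullSpace 0 = ⊥ := rfl

lemma fullSpace_succ (V : FlagManifold τ) (i : Fin d) : V.fullSpace i.succ = V.space i := rfl

lemma fullSpace_castSucc (V : FlagManifold τ) (i : Fin d) :
    V.fullSpace i.castSucc = V.prevSpace i := rfl

lemma fullSpace_mono (V : FlagManifold τ) : Monotone V.fullSpace := by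
  intro k l h
  induction k using Fin.cases with
  | zero => exact bot_le
  | succ i =>
    induction l using Fin.cases with
    | zero => exact absurd h (by simp)
    | succ j => exact V.strictMono.monotone (by simpa using h)

lemma finrank_prevSpace (V : FlagManifold τ) (i : Fin d) :
    Module.finrank ℝ (V.prevSpace i) = τ.prevDim i := by
  rw [prevSpace, prevDim]
  induction i.castSucc using Fin.cases with
  | zero => exact finrank_bot _ _
  | succ i => exact V.finrank_eq i

lemma prevSpace_le (V : FlagManifold τ) (i : Fin d) : V.prevSpace i ≤ V.space i :=
  V.fullSpace_mono i.castSucc_lt_succ.le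

lemma projector_eq_orthProj (V : FlagManifold τ) (i : Fin d) :
    V.projector i = orthProj (V.space i ⊓ (V.prevSpace i)ᗮ) := by
  apply Matrix.toEuclideanLin.injective
  rw [projector, LinearEquiv.apply_symm_apply, ← Matrix.coe_toEuclideanCLM_eq_toEuclideanLin,
    toEuclideanCLM_orthProj]

lemma projector_eq_sub (V : FlagManifold τ) (i : Fin d) :
    V.projector i = orthProj (V.fullSpace i.succ) - orthProj (V.fullSpace i.castSucc) := by
  rw [projector_eq_orthProj, orthProj_inf_orthogonal (V.prevSpace_le i)]
  rfl

lemma orthProj_bot : orthProj (⊥ : Submodule ℝ (EuclideanSpace ℝ (Fin n))) = 0 := by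
  simp [orthProj]

/-- The sum of the differences telescopes; the projections onto the spaces are thus linear in the
reduced coordinates. -/
lemma partialSum_projector (V : FlagManifold τ) (k : Fin (d + 1)) :
    Fin.partialSum V.projector k = orthProj (V.fullSpace k) := by
  induction k using Fin.induction with
  | zero => rw [Fin.partialSum_zero, fullSpace_zero, orthProj_bot]
  | succ i ih => rw [Fin.partialSum_succ, ih, projector_eq_sub, add_sub_cancel]

lemma reducedCoord_mem (V : FlagManifold τ) : V.reducedCoord ∈ reducedMatrices τ := by
  refine ⟨V.projector, rfl, fun i => ?_, fun i => ?_, fun i => ?_, fun i j hij => ?_⟩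
  · rw [projector_eq_orthProj, orthProj_mul_self]
  · rw [projector_eq_orthProj, transpose_orthProj]
  · rw [projector_eq_sub, Matrix.trace_sub, trace_orthProj, trace_orthProj, fullSpace_succ,
      fullSpace_castSucc, V.finrank_eq, finrank_prevSpace]
  · rw [projector_eq_orthProj, projector_eq_orthProj]
    -- The `j`-th piece lies in the complement of `V_{j-1}`, and `V_{j-1}` contains `V_i`, hence the
    -- `i`-th piece.
    refine orthProj_mul_eq_zero (inf_le_right.trans (Submodule.orthogonal_le (inf_le_left.trans ?_)))
    exact V.fullSpace_mono (show i.succ ≤ j.castSucc from hij)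

lemma reducedCoord_injective : Function.Injective (reducedCoord (τ := τ)) := by
  intro V W h
  have h1 : V.projector = W.projector := Matrix.blockDiagonal_injective h
  ext1
  funext i
  rw [← fullSpace_succ, ← fullSpace_succ]
  apply orthProj_injective
  rw [← partialSum_projector, ← partialSum_projector, h1]

/-! ### From reduced coordinates back to a flag -/

section Reconstruct

variable {R : Fin d → Matrix (Fin n) (Fin n) ℝ}

lemma partialSum_mul_eq_zero (h0 : ∀ i j, i < j → R i * R j = 0) (k : Fin (d + 1)) (j : Fin d)
    (hk : k ≤ j.castSucc) : Fin.partialSum R k * R j = 0 := by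
  induction k using Fin.induction with
  | zero => rw [Fin.partialSum_zero, zero_mul]
  | succ i ih =>
    rw [Fin.partialSum_succ, add_mul, ih (i.castSucc_lt_succ.le.trans hk), h0 i j hk, add_zero]

lemma transpose_partialSum (h2 : ∀ i, (R i)ᵀ = R i) (k : Fin (d + 1)) :
    (Fin.partialSum R k)ᵀ = Fin.partialSum R k := by
  induction k using Fin.induction with
  | zero => simp
  | succ i ih => rw [Fin.partialSum_succ, Matrix.transpose_add, ih, h2]

lemma mul_partialSum_eq_zero (h2 : ∀ i, (R i)ᵀ = R i) (h0 : ∀ i j, i < j → R i * R j = 0)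
    (k : Fin (d + 1)) (j : Fin d) (hk : k ≤ j.castSucc) : R j * Fin.partialSum R k = 0 := by
  have h := congrArg Matrix.transpose (partialSum_mul_eq_zero h0 k j hk)
  rwa [Matrix.transpose_mul, h2, transpose_partialSum h2, Matrix.transpose_zero] at h

/-- Both cross terms vanish: one by hypothesis, the other by transposition. -/
lemma partialSum_mul_self (h1 : ∀ i, R i * R i = R i) (h2 : ∀ i, (R i)ᵀ = R i)
    (h0 : ∀ i j, i < j → R i * R j = 0) (k : Fin (d + 1)) :
    Fin.partialSum R k * Fin.partialSum R k = Fin.partialSum R k := by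
  induction k using Fin.induction with
  | zero => simp
  | succ i ih =>
    rw [Fin.partialSum_succ, add_mul, mul_add, mul_add, ih, h1,
      partialSum_mul_eq_zero h0 _ _ le_rfl, mul_partialSum_eq_zero h2 h0 _ _ le_rfl, zero_add,
      add_zero]

lemma trace_partialSum (ht : ∀ i, (R i).trace = (τ.dim i : ℝ) - (τ.prevDim i : ℝ))
    (k : Fin (d + 1)) :
    (Fin.partialSum R k).trace = ((Fin.cons 0 τ.dim : Fin (d + 1) → ℕ) k : ℝ) := by
  induction k using Fin.induction with
  | zero => simp
  | succ i ih =>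
    rw [Fin.partialSum_succ, Matrix.trace_add, ih, ht, prevDim, Fin.cons_succ]
    ring

lemma matrixRange_le {S T : Matrix (Fin n) (Fin n) ℝ} (h : T * S = S) :
    matrixRange S ≤ matrixRange T := by
  rintro _ ⟨x, rfl⟩
  refine ⟨Matrix.toEuclideanLin S x, ?_⟩
  rw [← Matrix.coe_toEuclideanCLM_eq_toEuclideanLin, ← Matrix.coe_toEuclideanCLM_eq_toEuclideanLin]
  have := congrArg (Matrix.toEuclideanCLM (n := Fin n) (𝕜 := ℝ)) h
  rw [map_mul] at this
  exact DFunLike.congr_fun this x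

lemma matrixRange_partialSum_mono (h1 : ∀ i, R i * R i = R i) (h2 : ∀ i, (R i)ᵀ = R i)
    (h0 : ∀ i j, i < j → R i * R j = 0) :
    Monotone fun k : Fin (d + 1) => matrixRange (Fin.partialSum R k) := by
  refine Fin.monotone_iff_le_succ.2 fun i => matrixRange_le ?_
  rw [Fin.partialSum_succ, add_mul, partialSum_mul_self h1 h2 h0,
    mul_partialSum_eq_zero h2 h0 _ _ le_rfl, add_zero]

/-- The flag consists of the ranges of the partial sums. The traces telescope to the prescribed
dimensions, and these make the inclusions strict. -/
lemma exists_projector_eq (h1 : ∀ i, R i * R i = R i) (h2 : ∀ i, (R i)ᵀ = R i)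
    (ht : ∀ i, (R i).trace = (τ.dim i : ℝ) - (τ.prevDim i : ℝ))
    (h0 : ∀ i j, i < j → R i * R j = 0) : ∃ V : FlagManifold τ, V.projector = R := by
  have hr : ∀ i : Fin d, Module.finrank ℝ (matrixRange (Fin.partialSum R i.succ)) = τ.dim i := by
    intro i
    have h := finrank_matrixRange (partialSum_mul_self h1 h2 h0 i.succ)
    rw [trace_partialSum ht, Fin.cons_succ] at h
    exact_mod_cast h
  let V : FlagManifold τ :=
    { space := fun i => matrixRange (Fin.partialSum R i.succ)
      strictMono := fun i j hij => by
        refine lt_of_le_of_ne (matrixRange_partialSum_mono h1 h2 h0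
          (Fin.succ_le_succ_iff.2 hij.le)) fun h => (τ.strictMono hij).ne ?_
        rw [← hr i, ← hr j]
        exact congrArg (fun W : Submodule ℝ _ => Module.finrank ℝ W) h
      finrank_eq := hr }
  have hV : ∀ k, orthProj (V.fullSpace k) = Fin.partialSum R k := by
    intro k
    induction k using Fin.cases with
    | zero => rw [fullSpace_zero, orthProj_bot, Fin.partialSum_zero]
    | succ i => exact orthProj_matrixRange (partialSum_mul_self h1 h2 h0 _)
                  (transpose_partialSum h2 _)
  refine ⟨V, funext fun i => ?_⟩
  rw [projector_eq_sub, hV, hV, Fin.partialSum_succ, add_sub_cancel_left]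

end Reconstruct

/-- Flags correspond bijectively to their reduced projection coordinates. -/
noncomputable def reducedEquiv (τ : FlagType n d) : FlagManifold τ ≃ reducedMatrices τ :=
  Equiv.ofBijective (fun V => ⟨V.reducedCoord, V.reducedCoord_mem⟩)
    ⟨fun _ _ h => reducedCoord_injective (congrArg Subtype.val h), by
      rintro ⟨_, R, rfl, h1, h2, ht, h0⟩
      obtain ⟨V, rfl⟩ := exists_projector_eq h1 h2 ht h0
      exact ⟨V, rfl⟩⟩

end FlagManifold

/-! ### Smoothness of matrix operations -/

namespace FlagManifold

open FlagType

variable {n d : ℕ} {τ : FlagType n d}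

lemma contDiffAt_det {E ι : Type*} [NormedAddCommGroup E] [NormedSpace ℝ E] [Fintype ι]
    [DecidableEq ι] {f : E → Matrix ι ι ℝ} {x : E}
    (hf : ∀ a b, ContDiffAt ℝ ∞ (fun y => f y a b) x) : ContDiffAt ℝ ∞ (fun y => (f y).det) x := by
  simp only [Matrix.det_apply']
  exact ContDiffAt.sum fun σ _ => contDiffAt_const.mul (contDiffAt_prod fun c _ => hf _ _)

lemma contDiffAt_mul_apply {E ι κ l : Type*} [NormedAddCommGroup E] [NormedSpace ℝ E] [Fintype κ]
    {f : E → Matrix ι κ ℝ} {g : E → Matrix κ l ℝ} {x : E}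
    (hf : ∀ a b, ContDiffAt ℝ ∞ (fun y => f y a b) x)
    (hg : ∀ a b, ContDiffAt ℝ ∞ (fun y => g y a b) x) (a : ι) (b : l) :
    ContDiffAt ℝ ∞ (fun y => (f y * g y) a b) x := by
  simp only [Matrix.mul_apply]
  exact ContDiffAt.sum fun c _ => (hf _ _).mul (hg _ _)

/-- By Cramer's rule an entry of the inverse is a determinant divided by `det (f y)`. -/
lemma contDiffAt_inv_apply {E ι : Type*} [NormedAddCommGroup E] [NormedSpace ℝ E] [Fintype ι]
    [DecidableEq ι] {f : E → Matrix ι ι ℝ} {x : E}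
    (hf : ∀ a b, ContDiffAt ℝ ∞ (fun y => f y a b) x) (hx : (f x).det ≠ 0) (a b : ι) :
    ContDiffAt ℝ ∞ (fun y => (f y)⁻¹ a b) x := by
  simp only [Matrix.inv_def, Ring.inverse_eq_inv', Matrix.smul_apply, smul_eq_mul]
  refine ((contDiffAt_det hf).inv hx).mul ?_
  simp only [Matrix.adjugate_apply]
  refine contDiffAt_det fun a b => ?_
  simp only [Matrix.updateRow_apply]
  split_ifs
  · exact contDiffAt_const
  · exact hf _ _

lemma contDiffAt_lu {E : Type*} [NormedAddCommGroup E] [NormedSpace ℝ E]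
    {f : E → Matrix (Fin n) (Fin n) ℝ} {x : E} (hf : ∀ a b, ContDiffAt ℝ ∞ (fun y => f y a b) x)
    (hx : ∀ i, (lead (f x) (τ.dim i)).det ≠ 0) :
    ContDiffAt ℝ ∞ (fun y => (lu (f y) : τ.Model)) x := by
  rw [contDiffAt_euclidean]
  intro p
  exact contDiffAt_mul_apply (fun _ _ => hf _ _)
    (contDiffAt_inv_apply (fun _ _ => hf _ _) (hx _)) _ _

/-! ### Projection onto a column span through the Gram matrix -/

section Gram

variable (g : GL (Fin n) ℝ) (m : ℕ)

/-- The columns are independent, so their Gram matrix is positive definite. -/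
lemma det_gram_cols_ne_zero :
    ((cols (g : Matrix (Fin n) (Fin n) ℝ) m)ᵀ * cols (g : Matrix (Fin n) (Fin n) ℝ) m).det ≠ 0 := by
  have h1 : Function.Injective (cols (g : Matrix (Fin n) (Fin n) ℝ) m).mulVec := by
    rw [Matrix.mulVec_injective_iff]
    exact (Matrix.linearIndependent_cols_iff_isUnit.2 g.isUnit).comp _ Subtype.val_injective
  have h2 := (Matrix.PosDef.conjTranspose_mul_self _ h1).det_pos
  rw [Matrix.conjTranspose_eq_transpose_of_trivial] at h2
  exact h2.ne'

/-- The right-hand side `S` is a symmetric idempotent fixing every column of `C`, so its range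
contains the span. Cyclicity of the trace gives `tr S = tr (G⁻¹ G) = m`, so the dimensions agree. -/
lemma orthProj_columnSpan (hm : m ≤ n) : orthProj (columnSpan (g : Matrix (Fin n) (Fin n) ℝ) m) =
    cols (g : Matrix (Fin n) (Fin n) ℝ) m * ((cols (g : Matrix (Fin n) (Fin n) ℝ) m)ᵀ *
      cols (g : Matrix (Fin n) (Fin n) ℝ) m)⁻¹ * (cols (g : Matrix (Fin n) (Fin n) ℝ) m)ᵀ := by
  have hdet := det_gram_cols_ne_zero g m
  set C := cols (g : Matrix (Fin n) (Fin n) ℝ) m with hC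
  set G := Cᵀ * C with hG
  have hGu : IsUnit G.det := hdet.isUnit
  set S := C * G⁻¹ * Cᵀ with hS
  have hSC : S * C = C := by
    rw [hS, Matrix.mul_assoc, ← hG, Matrix.mul_assoc, Matrix.nonsing_inv_mul _ hGu, Matrix.mul_one]
  have h1 : S * S = S := by
    conv_lhs => rw [hS, ← Matrix.mul_assoc, ← Matrix.mul_assoc, ← hS, hSC]
  have h2 : Sᵀ = S := by
    have h3 : Gᵀ = G := by rw [hG, Matrix.transpose_mul, Matrix.transpose_transpose]
    rw [hS, Matrix.transpose_mul, Matrix.transpose_mul, Matrix.transpose_transpose,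
      Matrix.transpose_nonsing_inv, h3, Matrix.mul_assoc]
  have hle : columnSpan (g : Matrix (Fin n) (Fin n) ℝ) m ≤ matrixRange S := by
    refine Submodule.span_le.2 ?_
    rintro _ ⟨b, hb, rfl⟩
    refine ⟨column (g : Matrix (Fin n) (Fin n) ℝ) b, ?_⟩
    ext a
    exact congrFun (congrFun hSC a) ⟨b, hb⟩
  rw [← orthProj_matrixRange h1 h2]
  congr 1
  refine Submodule.eq_of_le_of_finrank_eq hle ?_
  have h4 := finrank_matrixRange h1
  have h6 : S.trace = Fintype.card {c : Fin n // (c : ℕ) < m} := by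
    rw [hS, Matrix.mul_assoc, Matrix.trace_mul_comm, Matrix.mul_assoc, ← hG,
      Matrix.nonsing_inv_mul _ hGu, Matrix.trace_one]
  have h5 : Fintype.card {c : Fin n // (c : ℕ) < m} = m := by
    rw [Fintype.card_subtype, Fin.card_filter_val_lt, min_eq_right hm]
  rw [finrank_columnSpan g hm]
  rw [h6, h5] at h4
  exact_mod_cast h4.symm

end Gram

/-! ### Smoothness of the coordinates and of their local inverse -/

/-- The reduced projection coordinates of a flag, as a point of a normed space. -/
noncomputable def coordFun (V : FlagManifold τ) : (Fin n × Fin d) → (Fin n × Fin d) → ℝ :=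
  fun a b => V.reducedCoord a b

lemma contDiffAt_orthProj_param (g : GL (Fin n) ℝ) (k : Fin (d + 1)) (x : τ.Model) (a b : Fin n) :
    ContDiffAt ℝ ∞ (fun y => orthProj ((param τ g y).fullSpace k) a b) x := by
  induction k using Fin.cases with
  | zero => simp only [fullSpace_zero]; exact contDiffAt_const
  | succ i =>
    have hy : ∀ y, (param τ g y).fullSpace i.succ =
      columnSpan ((g * τ.lower y : GL (Fin n) ℝ) : Matrix (Fin n) (Fin n) ℝ) (τ.dim i) := fun _ => rfl
    simp only [hy, orthProj_columnSpan _ _ (τ.dim_lt i).le]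
    have hC : ∀ a c, ContDiffAt ℝ ∞ (fun y : τ.Model =>
        cols ((g * τ.lower y : GL (Fin n) ℝ) : Matrix (Fin n) (Fin n) ℝ) (τ.dim i) a c) x :=
      fun a c => (contDiff_entry (g : Matrix (Fin n) (Fin n) ℝ) a c).contDiffAt
    have hCT : ∀ c a, ContDiffAt ℝ ∞ (fun y : τ.Model =>
        (cols ((g * τ.lower y : GL (Fin n) ℝ) : Matrix (Fin n) (Fin n) ℝ) (τ.dim i))ᵀ c a) x :=
      fun c a => hC a c
    exact contDiffAt_mul_apply (contDiffAt_mul_apply hC (contDiffAt_inv_apply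
      (contDiffAt_mul_apply hCT hC) (det_gram_cols_ne_zero _ _))) hCT a b

lemma contDiff_coordFun_param (g : GL (Fin n) ℝ) :
    ContDiff ℝ ∞ fun x : τ.Model => coordFun (param τ g x) := by
  rw [contDiff_iff_contDiffAt]
  intro x
  refine contDiffAt_pi.2 fun p => contDiffAt_pi.2 fun q => ?_
  simp only [coordFun, reducedCoord, Matrix.blockDiagonal_apply, projector_eq_sub,
    Matrix.sub_apply]
  split_ifs
  · exact (contDiffAt_orthProj_param g _ x _ _).sub (contDiffAt_orthProj_param g _ x _ _)
  · exact contDiffAt_const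

/-- Any invertible `g` extends to a matrix depending smoothly on the reduced projection
coordinates, whose columns are adapted to the flag. -/
lemma exists_adapted_matrix (g : GL (Fin n) ℝ) :
    ∃ H : ((Fin n × Fin d) → (Fin n × Fin d) → ℝ) → Matrix (Fin n) (Fin n) ℝ,
      (∀ a b, ContDiff ℝ ∞ fun M => H M a b) ∧
      H (coordFun (ofGL τ g)) = g ∧
      ∀ (V : FlagManifold τ) (i : Fin d) (b : Fin n), (b : ℕ) < τ.dim i →
        column (H (coordFun V)) b ∈ V.space i := by
  -- `κ b` is the least `i` for which column `b` must lie in `V_i`; `none` marks the columns past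
  -- `n_d`, on which there is no condition.
  have hκ : ∀ b : Fin n, ∃ o : Option (Fin d), (∀ i ∈ o, (b : ℕ) < τ.dim i) ∧
      ∀ j, (b : ℕ) < τ.dim j → ∃ i ∈ o, i ≤ j := by
    intro b
    by_cases h : ∃ i, (b : ℕ) < τ.dim i
    · obtain ⟨i₀, hi₀⟩ := h
      obtain ⟨i, hi, hmin⟩ := (Finset.univ.filter fun i : Fin d =>
        (b : ℕ) < τ.dim i).exists_min_image id ⟨i₀, by simpa using hi₀⟩
      simp only [Finset.mem_filter, Finset.mem_univ, true_and, id] at hi hmin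
      exact ⟨some i, by simpa using hi, fun j hj => ⟨i, rfl, hmin j hj⟩⟩
    · exact ⟨none, by simp, fun j hj => absurd ⟨j, hj⟩ h⟩
  choose κ hκ1 hκ2 using hκ
  -- Defined on all ambient matrices by summing diagonal blocks; it is a projection only at points
  -- coming from flags.
  let T : ((Fin n × Fin d) → (Fin n × Fin d) → ℝ) → Option (Fin d) → Matrix (Fin n) (Fin n) ℝ :=
    fun M o => o.elim 1 fun i => Fin.partialSum (Matrix.blockDiag (Matrix.of M)) i.succ
  have hT : ∀ (V : FlagManifold τ) i, T (coordFun V) (some i) = orthProj (V.space i) := by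
    intro V i
    have h : Matrix.blockDiag (Matrix.of (coordFun V)) = V.projector :=
      Matrix.blockDiag_blockDiagonal _
    change Fin.partialSum (Matrix.blockDiag (Matrix.of (coordFun V))) i.succ = _
    rw [h, partialSum_projector, fullSpace_succ]
  have hTd : ∀ o a b, ContDiff ℝ ∞ fun M => T M o a b := by
    rintro (_ | i) a b
    · exact contDiff_const
    · change ContDiff ℝ ∞ fun M : (Fin n × Fin d) → (Fin n × Fin d) → ℝ =>
        Fin.partialSum (Matrix.blockDiag (Matrix.of M)) i.succ a b
      induction i.succ using Fin.induction with
      | zero => simp only [Fin.partialSum_zero]; exact contDiff_const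
      | succ j ih =>
        simp only [Fin.partialSum_succ, Matrix.add_apply]
        refine ih.add ?_
        simp only [Matrix.blockDiag_apply, Matrix.of_apply]
        exact contDiff_apply_apply ℝ ℝ _ _
  refine ⟨fun M => Matrix.of fun a b => (T M (κ b) * (g : Matrix (Fin n) (Fin n) ℝ)) a b, ?_, ?_, ?_⟩
  · intro a b
    simp only [Matrix.of_apply, Matrix.mul_apply]
    exact ContDiff.sum fun c _ => (hTd _ _ _).mul contDiff_const
  -- At the base flag each projection fixes the column it acts on.
  · ext a b
    change (T (coordFun (ofGL τ g)) (κ b) * (g : Matrix (Fin n) (Fin n) ℝ)) a b = _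
    cases hb : κ b with
    | none =>
      change ((1 : Matrix (Fin n) (Fin n) ℝ) * (g : Matrix (Fin n) (Fin n) ℝ)) a b = _
      rw [one_mul]
    | some i =>
      have hmem : column (g : Matrix (Fin n) (Fin n) ℝ) b ∈ (ofGL τ g).space i :=
        Submodule.subset_span ⟨b, hκ1 b i hb, rfl⟩
      have h := (Submodule.starProjection_eq_self_iff).2 hmem
      rw [← toEuclideanCLM_orthProj, ← hT] at h
      exact congrArg (fun v : EuclideanSpace ℝ (Fin n) => v a) h
  · intro V j b hj
    obtain ⟨i, hi, hij⟩ := hκ2 b j hj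
    refine V.strictMono.monotone hij ?_
    have h := (V.space i).starProjection_apply_mem (column (g : Matrix (Fin n) (Fin n) ℝ) b)
    rw [← toEuclideanCLM_orthProj, ← hT] at h
    convert h using 1
    ext a
    change (T (coordFun V) (κ b) * (g : Matrix (Fin n) (Fin n) ℝ)) a b = _
    rw [Option.mem_def.1 hi]
    rfl

/-- Near a flag in the image of a chart, the chart is a smooth function of the reduced projection
coordinates. -/
lemma exists_local_inverse (g : GL (Fin n) ℝ) (x : τ.Model) :
    ∃ ρ : ((Fin n × Fin d) → (Fin n × Fin d) → ℝ) → τ.Model,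
      ContDiffAt ℝ ∞ ρ (coordFun (param τ g x)) ∧
      ∀ᶠ M in nhds (coordFun (param τ g x)), ∀ V : FlagManifold τ, coordFun V = M →
        V = param τ g (ρ M) := by
  obtain ⟨H, hHd, hH, hHV⟩ := exists_adapted_matrix (τ := τ) (g * τ.lower x)
  have hHd' : ∀ M a b, ContDiffAt ℝ ∞ (fun M => H M a b) M := fun _ a b => (hHd a b).contDiffAt
  -- Removing `g` makes the value at the base point `L(x)`, whose leading minors are all `1`; they
  -- stay nonzero nearby.
  let A := fun M => ((g⁻¹ : GL (Fin n) ℝ) : Matrix (Fin n) (Fin n) ℝ) * H M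
  have hA : ∀ M a b, ContDiffAt ℝ ∞ (fun M => A M a b) M := fun M =>
    contDiffAt_mul_apply (fun _ _ => contDiffAt_const) (hHd' M)
  have hA0 : A (coordFun (param τ g x)) = τ.lowerMatrix x := by
    change _ * H (coordFun (ofGL τ (g * τ.lower x))) = _
    rw [hH, ← Units.val_mul, inv_mul_cancel_left, coe_lower]
  have hlead : ∀ i, (lead (A (coordFun (param τ g x))) (τ.dim i)).det ≠ 0 := by
    intro i
    rw [hA0, det_lead_lowerMatrix]
    exact one_ne_zero
  refine ⟨fun M => lu (A M), contDiffAt_lu (hA _) hlead, ?_⟩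
  have e1 : ∀ᶠ M in nhds (coordFun (param τ g x)), (H M).det ≠ 0 := by
    refine (contDiffAt_det (hHd' _)).continuousAt.eventually_ne ?_
    change (H (coordFun (ofGL τ (g * τ.lower x)))).det ≠ 0
    rw [hH]
    exact ((Matrix.isUnit_iff_isUnit_det _).1 (g * τ.lower x).isUnit).ne_zero
  have e2 : ∀ᶠ M in nhds (coordFun (param τ g x)), ∀ i, (lead (A M) (τ.dim i)).det ≠ 0 :=
    Filter.eventually_all.2 fun i =>
      (contDiffAt_det fun _ _ => hA _ _ _).continuousAt.eventually_ne (hlead i)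
  filter_upwards [e1, e2]
  rintro _ h1 h2 V rfl
  have hu : IsUnit (H (coordFun V)) := (Matrix.isUnit_iff_isUnit_det _).2 h1.isUnit
  -- The adapted columns lie in the spaces of `V`, and invertibility makes the dimensions match.
  have hV : ofGL τ hu.unit = V := by
    ext1
    funext i
    refine Submodule.eq_of_le_of_finrank_eq ?_ ?_
    · refine Submodule.span_le.2 ?_
      rintro _ ⟨b, hb, rfl⟩
      exact hHV V i b hb
    · rw [(ofGL τ hu.unit).finrank_eq, V.finrank_eq]
  have h3 := (ofGL_eq_lower_iff (τ := τ) (g⁻¹ * hu.unit) (lu (A (coordFun V)))).2 ⟨h2, rfl⟩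
  rw [← ofGL_mul_eq_iff g, mul_inv_cancel_left, hV] at h3
  exact h3

end FlagManifold

/-! ### Normal form of an immersion with a local left inverse -/

section NormalForm

variable {E F : Type*} [NormedAddCommGroup E] [NormedSpace ℝ E] [FiniteDimensional ℝ E]
  [NormedAddCommGroup F] [NormedSpace ℝ F] [FiniteDimensional ℝ F]

/-- An injective linear map is the restriction of an isomorphism to the first factor. -/
lemma exists_continuousLinearEquiv_prod_of_injective (D : E →L[ℝ] F)
    (hD : Function.Injective D) :
    ∃ e : (E × EuclideanSpace ℝ (Fin (Module.finrank ℝ F - Module.finrank ℝ E))) ≃L[ℝ] F,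
      ∀ u, e (u, 0) = D u := by
  obtain ⟨C, hC⟩ := (LinearMap.range D.toLinearMap).exists_isCompl
  let e₁ := LinearEquiv.ofInjective D.toLinearMap hD
  have h1 := Submodule.finrank_add_eq_of_isCompl hC
  rw [← e₁.finrank_eq] at h1
  let e₂ : EuclideanSpace ℝ (Fin (Module.finrank ℝ F - Module.finrank ℝ E)) ≃ₗ[ℝ] C :=
    LinearEquiv.ofFinrankEq _ _ (by rw [finrank_euclideanSpace_fin]; omega)
  refine ⟨((e₁.prodCongr e₂).trans (Submodule.prodEquivOfIsCompl _ _ hC)).toContinuousLinearEquiv,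
    fun u => ?_⟩
  simp [e₁]

/-- A smooth map that is near the identity to first order at `y` has a smooth local inverse which
is a chart. -/
lemma exists_chart_of_hasFDerivAt_id {G : F → F} (hG : ContDiff ℝ ∞ G) {y : F}
    (hy : HasFDerivAt G (ContinuousLinearMap.id ℝ F) y) :
    ∃ c : OpenPartialHomeomorph F F, c ∈ IsManifold.maximalAtlas 𝓘(ℝ, F) ∞ F ∧
      ∃ s : Set F, IsOpen s ∧ y ∈ s ∧ ∀ z ∈ s, G z ∈ c.source ∧ c (G z) = z := by
  have hy' : HasFDerivAt G ((ContinuousLinearEquiv.refl ℝ F : F ≃L[ℝ] F) : F →L[ℝ] F) y := hy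
  let φ := hG.contDiffAt.toOpenPartialHomeomorph G hy' (by simp)
  have hφy : y ∈ φ.source := hG.contDiffAt.mem_toOpenPartialHomeomorph_source hy' (by simp)
  -- The inverse is needed smooth on a whole open set, so the source is cut down to the points where
  -- the derivative of `G` is invertible.
  let U : Set F := fderiv ℝ G ⁻¹' Set.range ((↑) : (F ≃L[ℝ] F) → (F →L[ℝ] F))
  have hU : IsOpen U := ContinuousLinearEquiv.isOpen.preimage (hG.continuous_fderiv (by simp))
  have hyU : y ∈ U := ⟨ContinuousLinearEquiv.refl ℝ F, by rw [hy.fderiv]; rfl⟩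
  let ψ := φ.restrOpen U hU
  have hψ : ∀ z, ψ z = G z := fun _ => rfl
  have hs : ContDiffOn ℝ ∞ ψ.symm ψ.target := by
    intro z hz
    have hmem : ψ.symm z ∈ ψ.source := ψ.map_target hz
    obtain ⟨f, hf⟩ := hmem.2
    refine (ψ.contDiffAt_symm (f₀' := f) hz ?_ hG.contDiffAt).contDiffWithinAt
    rw [hf]
    exact (hG.differentiable (by simp) _).hasFDerivAt
  refine ⟨ψ.symm, ?_, ψ.source, ψ.open_source, ⟨hφy, hyU⟩, fun z hz =>
    ⟨ψ.map_source hz, ψ.left_inv hz⟩⟩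
  refine StructureGroupoid.mem_maximalAtlas_of_mem_groupoid _ ?_
  rw [contDiffGroupoid, mem_groupoid_of_pregroupoid]
  simp only [contDiffPregroupoid]
  constructor
  · simpa using hs
  · have h : ContDiffOn ℝ ∞ ψ ψ.source := hG.contDiffOn
    simp only [ψ.symm_symm, ψ.symm_target]
    simpa only [modelWithCornersSelf_coe, modelWithCornersSelf_coe_symm, Function.id_comp,
      Function.comp_id, Set.preimage_id, Set.range_id, Set.inter_univ] using h

/-- A smooth map with a differentiable local left inverse has the normal form of an immersion. -/
lemma exists_chart_of_leftInverse {ψ : E → F} (hψ : ContDiff ℝ ∞ ψ) {x : E} {ρ : F → E}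
    (hρ : DifferentiableAt ℝ ρ (ψ x)) (h : ∀ᶠ y in nhds x, ρ (ψ y) = y) :
    ∃ (e : (E × EuclideanSpace ℝ (Fin (Module.finrank ℝ F - Module.finrank ℝ E))) ≃L[ℝ] F)
      (c : OpenPartialHomeomorph F F), c ∈ IsManifold.maximalAtlas 𝓘(ℝ, F) ∞ F ∧
      ∃ s : Set E, IsOpen s ∧ x ∈ s ∧ ∀ y ∈ s, ψ y ∈ c.source ∧ c (ψ y) = e (y, 0) := by
  have hd : HasFDerivAt ψ (fderiv ℝ ψ x) x := (hψ.differentiable (by simp) x).hasFDerivAt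
  have hcomp : (fderiv ℝ ρ (ψ x)).comp (fderiv ℝ ψ x) = ContinuousLinearMap.id ℝ E :=
    (hρ.hasFDerivAt.comp x hd).unique ((hasFDerivAt_id x).congr_of_eventuallyEq h)
  have hinj : Function.Injective (fderiv ℝ ψ x) :=
    Function.LeftInverse.injective fun u => DFunLike.congr_fun hcomp u
  obtain ⟨e, he⟩ := exists_continuousLinearEquiv_prod_of_injective _ hinj
  let p : F →L[ℝ] E := (ContinuousLinearMap.fst ℝ E _).comp e.symm.toContinuousLinearMap
  -- `G` replaces the linear slice `e (y, 0) = Dψ(y)` by `ψ y`, where `Dψ` is the derivative at `x`.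
  -- Its own derivative at `e (x, 0)` is the identity, so its local inverse is a chart that
  -- straightens the image of `ψ`.
  let G : F → F := fun z => z + (ψ (p z) - fderiv ℝ ψ x (p z))
  have hp : ∀ y, p (e (y, 0)) = y := fun y => by simp [p]
  have hGe : ∀ y, G (e (y, 0)) = ψ y := fun y => by
    simp only [G, hp]
    rw [he, add_sub_cancel]
  have hG : ContDiff ℝ ∞ G := by fun_prop
  have hG' : HasFDerivAt G (ContinuousLinearMap.id ℝ F) (e (x, 0)) := by
    have h1 : HasFDerivAt (fun z => ψ (p z)) ((fderiv ℝ ψ x).comp p) (e (x, 0)) := by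
      refine HasFDerivAt.comp _ ?_ p.hasFDerivAt
      rwa [hp]
    have h2 := (hasFDerivAt_id (𝕜 := ℝ) (e (x, 0))).add
      (h1.sub ((fderiv ℝ ψ x).comp p).hasFDerivAt)
    rw [sub_self, add_zero] at h2
    exact h2
  obtain ⟨c, hc, s, hs, hxs, hcs⟩ := exists_chart_of_hasFDerivAt_id hG hG'
  refine ⟨e, c, hc, (fun y => e (y, 0)) ⁻¹' s, hs.preimage (by fun_prop), hxs, fun y hy => ?_⟩
  have := hcs _ hy
  rwa [hGe] at this

end NormalForm

/-! ### Transport of a smooth structure along a homeomorphism -/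

section Transport

open OpenPartialHomeomorph

variable {H M N : Type*} [TopologicalSpace H] [TopologicalSpace M] [TopologicalSpace N]

/-- The homeomorphism cancels, so transported charts have the old transition maps. -/
lemma Homeomorph.symm_trans_transport (φ : M ≃ₜ N) (e e' : OpenPartialHomeomorph M H) :
    (φ.symm.transOpenPartialHomeomorph e).symm.trans (φ.symm.transOpenPartialHomeomorph e') ≈
      e.symm.trans e' := by
  refine ⟨?_, fun x _ => ?_⟩
  · ext x
    simp [Homeomorph.transOpenPartialHomeomorph]
  · exact congrArg e' (φ.symm_apply_apply (e.symm x))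

variable [ChartedSpace H M]

/-- The charted space structure transported along a homeomorphism. -/
@[reducible] def Homeomorph.transportChartedSpace (φ : M ≃ₜ N) : ChartedSpace H N where
  atlas := (fun e => φ.symm.transOpenPartialHomeomorph e) '' atlas H M
  chartAt := fun y => φ.symm.transOpenPartialHomeomorph (chartAt H (φ.symm y))
  mem_chart_source := fun y => mem_chart_source H (φ.symm y)
  chart_mem_atlas := fun _ => ⟨_, chart_mem_atlas H _, rfl⟩

variable {E : Type*} [NormedAddCommGroup E] [NormedSpace ℝ E] (I : ModelWithCorners ℝ E H)
  [IsManifold I ∞ M]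

lemma Homeomorph.isManifold_transport (φ : M ≃ₜ N) :
    @IsManifold ℝ _ E _ _ H _ I ∞ N _ φ.transportChartedSpace := by
  let _ := φ.transportChartedSpace (H := H)
  have : HasGroupoid N (contDiffGroupoid ∞ I) := by
    refine ⟨?_⟩
    rintro _ _ ⟨e, he, rfl⟩ ⟨e', he', rfl⟩
    exact (contDiffGroupoid ∞ I).mem_of_eqOnSource
      ((contDiffGroupoid ∞ I).compatible he he') (φ.symm_trans_transport e e')
  exact IsManifold.mk' I ∞ N

/-- Read in a chart and its transport, `φ` is the identity. -/
lemma Homeomorph.contMDiff_transport (φ : M ≃ₜ N) :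
    letI := φ.transportChartedSpace (H := H)
    ContMDiff I I ∞ φ := by
  let _ := φ.transportChartedSpace (H := H)
  have := φ.isManifold_transport I
  intro x
  let e := chartAt H x
  have he : φ.symm.transOpenPartialHomeomorph e ∈ IsManifold.maximalAtlas I ∞ N :=
    IsManifold.subset_maximalAtlas ⟨e, chart_mem_atlas H x, rfl⟩
  have h1 := contMDiffAt_of_mem_maximalAtlas (I := I) (n := ∞)
    (IsManifold.chart_mem_maximalAtlas x) (mem_chart_source H x)
  have h2 := contMDiffAt_symm_of_mem_maximalAtlas he
    (show e x ∈ _ from e.map_source (mem_chart_source H x))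
  refine (h2.comp x h1).congr_of_eventuallyEq ?_
  filter_upwards [e.open_source.mem_nhds (mem_chart_source H x)] with y hy
  exact congrArg φ (e.left_inv hy).symm

lemma Homeomorph.contMDiff_symm_transport (φ : M ≃ₜ N) :
    letI := φ.transportChartedSpace (H := H)
    ContMDiff I I ∞ φ.symm := by
  let _ := φ.transportChartedSpace (H := H)
  have := φ.isManifold_transport I
  intro y
  let e := chartAt H (φ.symm y)
  have hy := mem_chart_source H (φ.symm y)
  have he : φ.symm.transOpenPartialHomeomorph e ∈ IsManifold.maximalAtlas I ∞ N :=
    IsManifold.subset_maximalAtlas ⟨e, chart_mem_atlas H _, rfl⟩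
  have h1 := contMDiffAt_of_mem_maximalAtlas he (show y ∈ _ from hy)
  have h2 := contMDiffAt_symm_of_mem_maximalAtlas (I := I) (n := ∞)
    (IsManifold.chart_mem_maximalAtlas (φ.symm y)) (e.map_source hy)
  refine (h2.comp y h1).congr_of_eventuallyEq ?_
  filter_upwards [(e.open_source.preimage φ.symm.continuous).mem_nhds hy] with z hz
  exact (e.left_inv hz).symm

end Transport

/-! ### The homeomorphism and the main theorem -/

namespace FlagManifold

open FlagType

variable {n d : ℕ} {τ : FlagType n d}

lemma exists_chartAt_eq (V : FlagManifold τ) :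
    ∃ g, (chartAt τ.Model V).toPartialEquiv = chart τ g := ⟨_, rfl⟩

/-- Around each flag there is a chart whose inverse is the parametrisation by some `g`. -/
lemma exists_chartAt_symm_eq (V : FlagManifold τ) : ∃ g,
    (chartAt τ.Model V).target = Set.univ ∧ ⇑(chartAt τ.Model V).symm = param τ g := by
  obtain ⟨g, hg⟩ := exists_chartAt_eq V
  refine ⟨g, ?_, ?_⟩
  · rw [hg]
    rfl
  · change ⇑(chartAt τ.Model V).toPartialEquiv.symm = _
    rw [hg]
    rfl

lemma continuous_coordFun : Continuous (coordFun (τ := τ)) := by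
  rw [continuous_iff_continuousAt]
  intro V
  obtain ⟨g, -, hg⟩ := exists_chartAt_symm_eq V
  have hV := _root_.mem_chart_source τ.Model V
  refine ((contDiff_coordFun_param g).continuous.continuousAt.comp
    ((chartAt τ.Model V).continuousAt hV)).congr ?_
  filter_upwards [(chartAt τ.Model V).open_source.mem_nhds hV] with W hW
  rw [Function.comp_apply, ← hg, (chartAt τ.Model V).left_inv hW]

lemma isEmbedding_reducedMatrices : Topology.IsEmbedding fun (M : reducedMatrices τ)
    (a b : Fin n × Fin d) => (M : Matrix (Fin n × Fin d) (Fin n × Fin d) ℝ) a b :=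
  Topology.IsEmbedding.subtypeVal

/-- Flags are homeomorphic to their reduced projection coordinates. -/
noncomputable def reducedHomeomorph (τ : FlagType n d) : FlagManifold τ ≃ₜ reducedMatrices τ where
  toEquiv := reducedEquiv τ
  continuous_toFun := Continuous.subtype_mk continuous_coordFun reducedCoord_mem
  continuous_invFun := by
    rw [continuous_iff_continuousAt]
    intro M
    obtain ⟨V, rfl⟩ := (reducedEquiv τ).surjective M
    obtain ⟨g, ht, hg⟩ := exists_chartAt_symm_eq V
    have hV : param τ g (chartAt τ.Model V V) = V := by
      rw [← hg, (chartAt τ.Model V).left_inv (_root_.mem_chart_source τ.Model V)]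
    have hp : Continuous (param τ g) := by
      rw [← hg, ← continuousOn_univ, ← ht]
      exact (chartAt τ.Model V).continuousOn_symm
    obtain ⟨ρ, hρ, hρV⟩ := exists_local_inverse g (chartAt τ.Model V V)
    rw [hV] at hρ hρV
    have hc : ContinuousAt (fun M : reducedMatrices τ =>
        (fun a b => M.1 a b : (Fin n × Fin d) → (Fin n × Fin d) → ℝ)) (reducedEquiv τ V) :=
      isEmbedding_reducedMatrices.continuous.continuousAt
    -- Near the coordinates of `V` the inverse is `M ↦ param τ g (ρ M)`. This needs `ρ` to recover
    -- every flag with nearby coordinates, not only those known to lie in the chart.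
    have h1 : ContinuousAt (fun M : reducedMatrices τ => param τ g (ρ fun a b => M.1 a b))
        (reducedEquiv τ V) :=
      hp.continuousAt.comp (ContinuousAt.comp (g := ρ) hρ.continuousAt hc)
    refine h1.congr ?_
    filter_upwards [hc.eventually hρV] with M hM
    refine (hM ((reducedEquiv τ).symm M) ?_).symm
    exact congrArg Subtype.val ((reducedEquiv τ).apply_symm_apply M)

end FlagManifold

/-- The set of reduced projection coordinates is an embedded submanifold of `ℝ^(nd × nd)`, and the
map that sends a flag to its reduced projection coordinates is a diffeomorphism onto it. -/
theorem mainTheorem11 {n d : ℕ} (τ : FlagType n d) :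
    ∃ _ : ChartedSpace τ.Model (reducedMatrices τ),
      IsManifold 𝓘(ℝ, τ.Model) ∞ (reducedMatrices τ) ∧
      Manifold.IsSmoothEmbedding 𝓘(ℝ, τ.Model)
        𝓘(ℝ, (Fin n × Fin d) → (Fin n × Fin d) → ℝ) ∞
        (fun (M : reducedMatrices τ) (a b : Fin n × Fin d) =>
          (M : Matrix (Fin n × Fin d) (Fin n × Fin d) ℝ) a b) ∧
      ∃ Φ : FlagManifold τ ≃ₘ^∞⟮𝓘(ℝ, τ.Model), 𝓘(ℝ, τ.Model)⟯ reducedMatrices τ,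
        ∀ V : FlagManifold τ,
          (Φ V : Matrix (Fin n × Fin d) (Fin n × Fin d) ℝ) = V.reducedCoord := by
  let φ := FlagManifold.reducedHomeomorph τ
  let inst : ChartedSpace τ.Model (reducedMatrices τ) := φ.transportChartedSpace
  have hman : IsManifold 𝓘(ℝ, τ.Model) ∞ (reducedMatrices τ) := φ.isManifold_transport _
  -- One complement, of the codimension of the submanifold, serves at every point.
  refine ⟨inst, hman, ⟨⟨EuclideanSpace ℝ (Fin (Module.finrank ℝ
    ((Fin n × Fin d) → (Fin n × Fin d) → ℝ) - Module.finrank ℝ τ.Model)), inferInstance,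
    inferInstance, fun M => ?_⟩, FlagManifold.isEmbedding_reducedMatrices⟩,
    ⟨φ.toEquiv, φ.contMDiff_transport _, φ.contMDiff_symm_transport _⟩, fun V => rfl⟩
  let e := chartAt τ.Model (φ.symm M)
  obtain ⟨g, ht, hg⟩ := FlagManifold.exists_chartAt_symm_eq (φ.symm M)
  let D : OpenPartialHomeomorph (reducedMatrices τ) τ.Model := φ.symm.transOpenPartialHomeomorph e
  have hD : D ∈ IsManifold.maximalAtlas 𝓘(ℝ, τ.Model) ∞ (reducedMatrices τ) :=
    IsManifold.subset_maximalAtlas ⟨e, chart_mem_atlas _ _, rfl⟩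
  have hMD : M ∈ D.source := mem_chart_source τ.Model (φ.symm M)
  have hDsymm : ∀ u, (fun a b => (D.symm u).1 a b) =
      FlagManifold.coordFun (FlagManifold.param τ g u) := fun u => by
    rw [← hg]
    rfl
  obtain ⟨ρ, hρ, hρV⟩ := FlagManifold.exists_local_inverse g (D M)
  have hleft : ∀ᶠ y in nhds (D M), ρ (FlagManifold.coordFun (FlagManifold.param τ g y)) = y := by
    filter_upwards [(FlagManifold.contDiff_coordFun_param g).continuous.continuousAt.eventually hρV]
      with y hy
    exact (FlagManifold.param_injective g (hy _ rfl)).symm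
  obtain ⟨L, c, hc, s, hs, hxs, hsc⟩ := exists_chart_of_leftInverse
    (FlagManifold.contDiff_coordFun_param g) (hρ.differentiableAt (by simp)) hleft
  have hA := D.isOpen_inter_preimage hs
  have hM := hDsymm (D M)
  rw [D.left_inv hMD] at hM
  -- The source chart is shrunk to the preimage of `s`, where the parametrisation is in normal form.
  refine Manifold.IsImmersionAtOfComplement.mk_of_continuousAt
    FlagManifold.isEmbedding_reducedMatrices.continuous.continuousAt L
    (D.restr (D.source ∩ D ⁻¹' s)) c ?_ ?_
    (restr_mem_maximalAtlas (contDiffGroupoid ∞ 𝓘(ℝ, τ.Model)) hD hA) hc ?_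
  · rw [D.restr_source, hA.interior_eq]
    exact ⟨hMD, hMD, hxs⟩
  · rw [hM]
    exact (hsc _ hxs).1
  · intro u hu
    have hu' : u ∈ D.target ∧ D.symm u ∈ D.source ∩ D ⁻¹' s := by
      have h := hu
      rw [OpenPartialHomeomorph.extend_target, D.restr_target, hA.interior_eq] at h
      exact h.1
    have hus : u ∈ s := by
      have := hu'.2.2
      rwa [Set.mem_preimage, D.right_inv hu'.1] at this
    have h1 := (hsc u hus).2
    rw [← hDsymm] at h1
    exact h1
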